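/- For every integer $\Delta\ge 3$ there exist a real number $c>0$ and an integer $n_0>0$ such that for every integer $n\ge n_0$ with $\Delta n$ even the following holds: there is at least one $\Delta$-regular simple graph on the vertex set $[n]=\{1,\dots,n\}$, and if $G_{n,\Delta}$ is chosen uniformly at random among all such graphs, then $$\Pr\bigl(G_{n,\Delta}\text{ has a frozen colouring}\bigr)\le e^{-cn}.$$ Here a frozen colouring of a $\Delta$-regular graph $G$ is a proper colouring of the vertices of $G$ with $\Delta+1$ colours such that, for every vertex $v$, every one of the $\Delta+1$ colours appears in the closed neighbourhood $N[v]=N(v)\cup\{v\}$. -/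

import Mathlib

/-- A proper colouring `α` of `G` is frozen if every colour appears in the closed neighbourhood
of every vertex. -/
def IsFrozen {V C : Type*} {G : SimpleGraph V} (α : G.Coloring C) : Prop :=
  ∀ (v : V) (a : C), ∃ u : V, (u = v ∨ G.Adj v u) ∧ α u = a

/-- `G` has a frozen proper colouring with the colours `Fin k`. -/
def HasFrozenColouring {V : Type*} (G : SimpleGraph V) (k : ℕ) : Prop :=
  ∃ α : G.Coloring (Fin k), IsFrozen α

open Classical in
/-- The finite set of all `d`-regular (simple, labelled) graphs with vertex set `Fin n`. -/
noncomputable def regularGraphs (d n : ℕ) : Finset (SimpleGraph (Fin n)) :=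
  Finset.univ.filter fun G => G.IsRegularOfDegree d

/-- The law of the random graph: the uniform distribution on the `d`-regular graphs with vertex
set `Fin n`, provided that there is one. -/
noncomputable def randomRegularGraph (d n : ℕ) (h : (regularGraphs d n).Nonempty) :
    PMF (SimpleGraph (Fin n)) :=
  PMF.uniformOfFinset (regularGraphs d n) h

open Finset SimpleGraph
open scoped Nat

/-! ### Weighted count of graphs that are almost regular -/

section NearRegular

open scoped Classical

variable {V : Type*}

/-! The proof is a first-moment count. Write d for Δ and t = d(d+1)/2. In a frozen colouring each
closed neighbourhood shows each colour exactly once, so any two colour classes are joined by a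
perfect matching. Hence n = (d+1)m with classes of size m, and at most (d+1)^n (m!)^t graphs have a
frozen colouring (`card_frozen_le`).

Against this, `le_card_regular` gives at least (tm)! 2^(tm) / (d!)^n regular graphs, up to a
polynomial factor. Edges are removed or added one at a time, and graphs are weighted by ∏
1/deficit!. A double count bounds the total weight step by step from the empty graph until only t
edges are missing (`le_factorial_mul_nearRegularWeight`). There the estimate degenerates, and
switchings supply the last t edges at a cost of n^4 each (`card_nearRegular_le`).

By Stirling, the quotient of the two bounds is polynomial in m times ((d+1)!^(d+1) / (2t)^t)^m. The
base is below 1 exactly when (d+1)!^2 < (d(d+1))^d, which is `factorial_succ_sq_lt`. -/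

theorem sdiff_edge_sup_edge {G : SimpleGraph V} {u v : V} (h : G.Adj u v) :
    G \ edge u v ⊔ edge u v = G := by
  rw [sdiff_sup_cancel]
  intro a b hab
  rw [edge_adj] at hab
  rcases hab with ⟨⟨rfl, rfl⟩ | ⟨rfl, rfl⟩, -⟩
  exacts [h, h.symm]

theorem sup_edge_sdiff_edge {G : SimpleGraph V} {u v : V} (h : ¬ G.Adj u v) :
    (G ⊔ edge u v) \ edge u v = G := by
  have h' : ¬ G.Adj v u := fun h' => h h'.symm
  ext a b
  simp only [sdiff_adj, sup_adj, edge_adj]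
  grind [SimpleGraph.Adj.ne]

theorem not_adj_sdiff_edge (G : SimpleGraph V) (u v : V) : ¬ (G \ edge u v).Adj u v := by
  intro h
  simp only [sdiff_adj, edge_adj] at h
  grind [SimpleGraph.Adj.ne]

variable [Fintype V]

/-- The degree of a vertex, with a decidability instance that does not depend on the graph. -/
noncomputable def SimpleGraph.deg (G : SimpleGraph V) (v : V) : ℕ :=
  #(univ.filter fun w => G.Adj v w)

theorem SimpleGraph.deg_eq_degree (G : SimpleGraph V) (v : V) [Fintype (G.neighborSet v)] :
    G.deg v = G.degree v := by
  rw [← card_neighborSet_eq_degree, deg, Fintype.card_subtype]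
  congr!

theorem SimpleGraph.deg_eq_sum_ite (G : SimpleGraph V) (v : V) :
    G.deg v = ∑ w, if G.Adj v w then 1 else 0 :=
  card_filter _ _

theorem SimpleGraph.deg_sup_edge_of_not_adj {G : SimpleGraph V} {u v : V} (huv : u ≠ v)
    (hadj : ¬ G.Adj u v) (w : V) :
    (G ⊔ edge u v).deg w
      = G.deg w + (if w = u then 1 else 0) + (if w = v then 1 else 0) := by
  have hadj' : ¬ G.Adj v u := fun h => hadj h.symm
  rw [deg_eq_sum_ite, deg_eq_sum_ite]
  trans ∑ x, ((if G.Adj w x then 1 else 0) + (if w = u then (if x = v then 1 else 0) else 0)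
        + (if w = v then (if x = u then 1 else 0) else 0))
  · refine sum_congr rfl fun x _ => ?_
    simp only [sup_adj, edge_adj]
    grind
  · rw [sum_add_distrib, sum_add_distrib]
    congr 1
    · congr 1
      split_ifs <;> simp
    · split_ifs <;> simp

/-- How many edges the vertex `v` of `G` lacks to have degree `d`. -/
noncomputable def SimpleGraph.deficit (G : SimpleGraph V) (d : ℕ) (v : V) : ℕ := d - G.deg v

theorem deg_add_deficit {G : SimpleGraph V} {d : ℕ} {v : V} (h : G.deg v ≤ d) :
    G.deg v + G.deficit d v = d :=
  Nat.add_sub_cancel' h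

/-- The graphs with maximum degree at most `d` that lack `k` edges to be `d`-regular. -/
noncomputable def nearRegular (V : Type*) [Fintype V] (d k : ℕ) : Finset (SimpleGraph V) :=
  univ.filter fun G => (∀ v, G.deg v ≤ d) ∧ ∑ v, G.deficit d v = 2 * k

theorem mem_nearRegular {d k : ℕ} {G : SimpleGraph V} :
    G ∈ nearRegular V d k ↔ (∀ v, G.deg v ≤ d) ∧ ∑ v, G.deficit d v = 2 * k := by
  simp [nearRegular]

theorem mem_nearRegular_zero {d : ℕ} {G : SimpleGraph V} :
    G ∈ nearRegular V d 0 ↔ ∀ v, G.deg v = d := by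
  simp only [mem_nearRegular, deficit, mul_zero, sum_eq_zero_iff, mem_univ, true_imp_iff,
    ← forall_and]
  exact forall_congr' fun v => by omega

theorem sum_deg_add_of_mem_nearRegular {d k : ℕ} {G : SimpleGraph V}
    (hG : G ∈ nearRegular V d k) : ∑ v, G.deg v + 2 * k = d * Fintype.card V := by
  obtain ⟨h1, h2⟩ := mem_nearRegular.1 hG
  rw [← h2, ← sum_add_distrib, sum_congr rfl fun v _ => deg_add_deficit (h1 v)]
  simp [mul_comm]

theorem mem_nearRegular_of_sum_deg {d k : ℕ} {G : SimpleGraph V} (h1 : ∀ v, G.deg v ≤ d)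
    (h2 : ∑ v, G.deg v + 2 * k = d * Fintype.card V) : G ∈ nearRegular V d k := by
  refine mem_nearRegular.2 ⟨h1, ?_⟩
  have h3 : ∑ v, G.deg v + ∑ v, G.deficit d v = d * Fintype.card V := by
    rw [← sum_add_distrib, sum_congr rfl fun v _ => deg_add_deficit (h1 v)]
    simp [mul_comm]
  omega

theorem sum_deg_sup_edge {G : SimpleGraph V} {u v : V} (huv : u ≠ v)
    (hadj : ¬ G.Adj u v) : ∑ w, (G ⊔ edge u v).deg w = ∑ w, G.deg w + 2 := by
  simp only [deg_sup_edge_of_not_adj huv hadj, sum_add_distrib]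
  simp

/-- The weight of a graph in a random process that adds edges one by one. -/
noncomputable def deficitWeight (d : ℕ) (G : SimpleGraph V) : ℝ := ∏ v, ((G.deficit d v)! : ℝ)⁻¹

theorem deficitWeight_nonneg (d : ℕ) (G : SimpleGraph V) : 0 ≤ deficitWeight d G :=
  prod_nonneg fun _ _ => by positivity

theorem deficitWeight_le_one (d : ℕ) (G : SimpleGraph V) : deficitWeight d G ≤ 1 :=
  prod_le_one (fun _ _ => by positivity) fun _ _ =>
    inv_le_one_of_one_le₀ (by exact_mod_cast Nat.factorial_pos _)

/-- Only the two ends lose a unit of deficit, and j/j! = 1/(j-1)!. The extra factor is the number of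
ways to join a free half-edge at u to one at v. -/
theorem deficitWeight_sup_edge {d : ℕ} {G : SimpleGraph V} {u v : V} (huv : u ≠ v)
    (hadj : ¬ G.Adj u v) (hu : G.deg u < d) (hv : G.deg v < d) :
    deficitWeight d (G ⊔ edge u v)
      = deficitWeight d G * ((G.deficit d u : ℝ) * (G.deficit d v : ℝ)) := by
  have e1 : ((G.deficit d u : ℝ) * (G.deficit d v : ℝ))
      = ∏ x, ((if x = u then (G.deficit d x : ℝ) else 1)
        * (if x = v then (G.deficit d x : ℝ) else 1)) := by
    rw [prod_mul_distrib]; simp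
  have fac : ∀ x, G.deg x < d → ((G.deficit d x)! : ℝ)⁻¹ * G.deficit d x
      = ((d - (G.deg x + 1))! : ℝ)⁻¹ := by
    intro x hx
    obtain ⟨j, rfl⟩ : ∃ j, d = G.deg x + 1 + j := ⟨d - (G.deg x + 1), by omega⟩
    have : G.deficit (G.deg x + 1 + j) x = j + 1 := by simp only [deficit]; omega
    rw [this, Nat.factorial_succ, Nat.add_sub_cancel_left]
    push_cast
    field_simp
  rw [e1, deficitWeight, deficitWeight, ← prod_mul_distrib]
  refine prod_congr rfl fun x _ => ?_
  rw [deficit, deg_sup_edge_of_not_adj huv hadj]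
  by_cases h1 : x = u
  · subst h1
    simp only [if_true, if_neg huv, mul_one, add_zero]
    exact (fac x hu).symm
  · by_cases h2 : x = v
    · subst h2
      simp only [if_true, if_neg h1, one_mul, add_zero]
      exact (fac x hv).symm
    · simp [h1, h2, deficit]

/-- The ordered pairs of vertices that can be joined in `G` with all degrees staying at most `d`. -/
noncomputable def addablePairs (d : ℕ) (G : SimpleGraph V) : Finset (V × V) :=
  univ.filter fun p => p.1 ≠ p.2 ∧ ¬ G.Adj p.1 p.2 ∧ G.deg p.1 < d ∧ G.deg p.2 < d

theorem sup_edge_mem_nearRegular {d k : ℕ} {G : SimpleGraph V} {u v : V}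
    (hG : G ∈ nearRegular V d (k + 1)) (huv : u ≠ v) (hadj : ¬ G.Adj u v)
    (hu : G.deg u < d) (hv : G.deg v < d) : G ⊔ edge u v ∈ nearRegular V d k := by
  refine mem_nearRegular_of_sum_deg (fun w => ?_) ?_
  · rw [deg_sup_edge_of_not_adj huv hadj]
    have := (mem_nearRegular.1 hG).1 w
    split_ifs with h1 h2 h2
    · exact absurd (h1.symm.trans h2) huv
    · subst h1; omega
    · subst h2; omega
    · omega
  · rw [sum_deg_sup_edge huv hadj]
    have := sum_deg_add_of_mem_nearRegular hG
    omega

theorem sdiff_edge_mem_nearRegular {d k : ℕ} {G : SimpleGraph V} {u v : V}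
    (hG : G ∈ nearRegular V d k) (hadj : G.Adj u v) :
    G \ edge u v ∈ nearRegular V d (k + 1) ∧ (u, v) ∈ addablePairs d (G \ edge u v) := by
  have hdeg := deg_sup_edge_of_not_adj hadj.ne (not_adj_sdiff_edge G u v)
  have hsum := sum_deg_sup_edge hadj.ne (not_adj_sdiff_edge G u v)
  rw [sdiff_edge_sup_edge hadj] at hsum
  simp only [sdiff_edge_sup_edge hadj] at hdeg
  have hle := (mem_nearRegular.1 hG).1
  have hG' := sum_deg_add_of_mem_nearRegular hG
  refine ⟨mem_nearRegular_of_sum_deg (fun w => ?_) (by omega), ?_⟩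
  · have := hle w
    have := hdeg w
    omega
  · simp only [addablePairs, mem_filter, mem_univ, true_and]
    refine ⟨hadj.ne, not_adj_sdiff_edge G u v, ?_, ?_⟩
    · have h1 := hle u
      have h2 := hdeg u
      simp only [if_true] at h2
      omega
    · have h1 := hle v
      have h2 := hdeg v
      simp only [if_true] at h2
      omega

/-- Adding an edge is a bijection from graphs with an addable ordered pair to graphs with an
oriented edge, and a graph lacking k edges has dn - 2k oriented edges. -/
theorem sum_addablePairs_eq (d k : ℕ) :
    ∑ G ∈ nearRegular V d (k + 1), ∑ p ∈ addablePairs d G,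
        deficitWeight d G * ((G.deficit d p.1 : ℝ) * (G.deficit d p.2 : ℝ))
      = ((d * Fintype.card V : ℝ) - 2 * k) * ∑ G ∈ nearRegular V d k, deficitWeight d G := by
  have hR : ((d * Fintype.card V : ℝ) - 2 * k) * ∑ G ∈ nearRegular V d k, deficitWeight d G
      = ∑ G ∈ nearRegular V d k, ∑ _p ∈ univ.filter (fun p : V × V => G.Adj p.1 p.2),
          deficitWeight d G := by
    rw [mul_sum]
    refine sum_congr rfl fun G hG => ?_
    rw [sum_const, nsmul_eq_mul]
    congr 1
    have h1 := sum_deg_add_of_mem_nearRegular hG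
    have h2 : #(univ.filter (fun p : V × V => G.Adj p.1 p.2)) = ∑ v, G.deg v := by
      simp only [card_filter, Fintype.sum_prod_type, deg_eq_sum_ite]
    rw [h2, sub_eq_iff_eq_add]
    exact_mod_cast h1.symm
  rw [hR, sum_sigma', sum_sigma']
  refine sum_bij' (fun x _ => ⟨x.1 ⊔ edge x.2.1 x.2.2, x.2⟩)
    (fun x _ => ⟨x.1 \ edge x.2.1 x.2.2, x.2⟩) ?_ ?_ ?_ ?_ ?_
  · rintro ⟨G, u, v⟩ h
    simp only [mem_sigma, addablePairs, mem_filter, mem_univ, true_and] at h ⊢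
    exact ⟨sup_edge_mem_nearRegular h.1 h.2.1 h.2.2.1 h.2.2.2.1 h.2.2.2.2,
      Or.inr ((edge_adj ..).2 ⟨Or.inl ⟨rfl, rfl⟩, h.2.1⟩)⟩
  · rintro ⟨G, u, v⟩ h
    simp only [mem_sigma, mem_filter, mem_univ, true_and] at h ⊢
    exact sdiff_edge_mem_nearRegular h.1 h.2
  · rintro ⟨G, u, v⟩ h
    simp only [mem_sigma, addablePairs, mem_filter, mem_univ, true_and] at h
    simp only [sup_edge_sdiff_edge h.2.2.1]
  · rintro ⟨G, u, v⟩ h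
    simp only [mem_sigma, mem_filter, mem_univ, true_and] at h
    simp only [sdiff_edge_sup_edge h.2]
  · rintro ⟨G, u, v⟩ h
    simp only [mem_sigma, addablePairs, mem_filter, mem_univ, true_and] at h
    exact (deficitWeight_sup_edge h.2.1 h.2.2.1 h.2.2.2.1 h.2.2.2.2).symm

theorem card_closedNeighbour_le {d : ℕ} {G : SimpleGraph V} (h : ∀ v, G.deg v ≤ d) (v : V) :
    #(univ.filter fun u => u = v ∨ G.Adj v u) ≤ d + 1 := by
  have : (univ.filter fun u => u = v ∨ G.Adj v u) = insert v (univ.filter fun u => G.Adj v u) := by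
    ext; simp
  rw [this]
  exact (card_insert_le _ _).trans (Nat.succ_le_succ (h v))

/-- Over all ordered pairs the products sum to (2k)^2. For each u, the excluded v lie in its closed
neighbourhood: at most d+1 vertices of deficit at most d. -/
theorem le_sum_addablePairs {d k : ℕ} {G : SimpleGraph V} (hG : G ∈ nearRegular V d k) :
    (2 * k : ℝ) * (2 * k - d * (d + 1))
      ≤ ∑ p ∈ addablePairs d G, ((G.deficit d p.1 : ℝ) * (G.deficit d p.2 : ℝ)) := by
  obtain ⟨h1, h2⟩ := mem_nearRegular.1 hG
  have h2' : ∑ v, (G.deficit d v : ℝ) = 2 * k := by exact_mod_cast h2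
  have e1 : ∑ p ∈ addablePairs d G, ((G.deficit d p.1 : ℝ) * (G.deficit d p.2 : ℝ))
      = ∑ u, (G.deficit d u : ℝ) *
          ∑ v, (if v = u ∨ G.Adj u v then 0 else (G.deficit d v : ℝ)) := by
    simp only [mul_sum]
    rw [addablePairs, sum_filter, Fintype.sum_prod_type]
    refine sum_congr rfl fun u _ => sum_congr rfl fun v _ => ?_
    by_cases hA : v = u ∨ G.Adj u v
    · rw [if_pos hA, mul_zero, if_neg]
      rintro ⟨h3, h4, -⟩
      rcases hA with rfl | hA
      exacts [h3 rfl, h4 hA]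
    · rw [if_neg hA]
      push Not at hA
      split_ifs with hB
      · rfl
      -- A distinct, non-adjacent pair fails to be addable only if an end is saturated, and then its
      -- product vanishes.
      · have : G.deficit d u = 0 ∨ G.deficit d v = 0 := by
          by_contra hC
          push Not at hC
          simp only [deficit] at hC
          exact hB ⟨hA.1.symm, hA.2, by dsimp only; omega, by dsimp only; omega⟩
        rcases this with h | h <;> simp [h]
  rw [e1, ← h2', sum_mul, h2']
  refine sum_le_sum fun u _ => mul_le_mul_of_nonneg_left ?_ (Nat.cast_nonneg _)
  have e2 : ∑ v, (G.deficit d v : ℝ)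
      ≤ ∑ v, ((if v = u ∨ G.Adj u v then 0 else (G.deficit d v : ℝ))
        + (if v = u ∨ G.Adj u v then (d : ℝ) else 0)) := by
    refine sum_le_sum fun v _ => ?_
    split_ifs
    · rw [zero_add]; exact_mod_cast Nat.sub_le _ _
    · simp
  rw [h2', sum_add_distrib, ← sum_filter _ (fun _ => (d : ℝ)), sum_const, nsmul_eq_mul] at e2
  have e3 : (#(univ.filter fun v => v = u ∨ G.Adj u v) : ℝ) ≤ d + 1 := by
    exact_mod_cast card_closedNeighbour_le h1 u
  have := mul_le_mul_of_nonneg_right e3 (Nat.cast_nonneg (α := ℝ) d)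
  linarith

/-- The total weight of the graphs that lack `k` edges. -/
noncomputable def nearRegularWeight (V : Type*) [Fintype V] (d k : ℕ) : ℝ :=
  ∑ G ∈ nearRegular V d k, deficitWeight d G

theorem nearRegularWeight_succ_le (d k : ℕ) :
    (2 * (k + 1) : ℝ) * (2 * (k + 1) - d * (d + 1)) * nearRegularWeight V d (k + 1)
      ≤ (d * Fintype.card V - 2 * k) * nearRegularWeight V d k := by
  rw [nearRegularWeight, nearRegularWeight, ← sum_addablePairs_eq, mul_sum]
  refine sum_le_sum fun G hG => ?_
  rw [← mul_sum, mul_comm]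
  have := le_sum_addablePairs hG
  push_cast at this
  exact mul_le_mul_of_nonneg_left this (deficitWeight_nonneg _ _)

theorem nearRegularWeight_le_card (d k : ℕ) : nearRegularWeight V d k ≤ #(nearRegular V d k) := by
  refine (sum_le_sum fun G _ => deficitWeight_le_one d G).trans ?_
  simp

theorem le_nearRegularWeight_of_eq {d e : ℕ} (he : d * Fintype.card V = 2 * e) :
    ((d ! : ℝ) ^ Fintype.card V)⁻¹ ≤ nearRegularWeight V d e := by
  have hb : (⊥ : SimpleGraph V) ∈ nearRegular V d e :=
    mem_nearRegular_of_sum_deg (by simp [deg]) (by simp [deg, he])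
  refine le_trans (le_of_eq ?_) (single_le_sum (fun G _ => deficitWeight_nonneg d G) hb)
  simp [deficitWeight, deficit, deg]

theorem le_factorial_mul_nearRegularWeight {d e t : ℕ} (he : d * Fintype.card V = 2 * e)
    (ht : d * (d + 1) = 2 * t) (hte : t ≤ e) :
    (e ! : ℝ) * 2 ^ e ≤ t ! * 2 ^ t * (d ! : ℝ) ^ Fintype.card V * nearRegularWeight V d t := by
  have he' : (d * Fintype.card V : ℝ) = 2 * e := by exact_mod_cast he
  have ht' : (d * (d + 1) : ℝ) = 2 * t := by exact_mod_cast ht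
  -- The factorials telescope the recursion: at k = t + j its factors are 2(t+j+1)·2(j+1) on the
  -- left and 2(i+1) on the right, where i + (t+j+1) = e. At j = e - t the factor (e-t)! cancels.
  have main : ∀ j, t + j ≤ e → ∀ i, i + (t + j) = e →
      nearRegularWeight V d (t + j) * (i ! * (t + j)! * j ! * 2 ^ (t + j))
        ≤ nearRegularWeight V d t * ((e - t)! * t ! * 2 ^ t) := by
    intro j
    induction j with
    | zero =>
      intro _ i hi
      obtain rfl : i = e - t := by omega
      simp
    | succ j ih =>
      intro hj i hi
      refine le_trans ?_ (ih (by omega) (i + 1) (by omega))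
      have h := nearRegularWeight_succ_le (V := V) d (t + j)
      have hi' : (i : ℝ) + (t + (j + 1)) = e := by exact_mod_cast hi
      rw [he', ht', ← hi'] at h
      push_cast at h
      have h' : (t + j + 1 : ℝ) * (2 * (j + 1)) * nearRegularWeight V d (t + j + 1)
          ≤ (i + 1) * nearRegularWeight V d (t + j) := by linarith
      have hp : (0 : ℝ) ≤ i ! * (t + j)! * j ! * 2 ^ (t + j) := by positivity
      have h3 := mul_le_mul_of_nonneg_right h' hp
      rw [← add_assoc, Nat.factorial_succ, Nat.factorial_succ, Nat.factorial_succ, pow_succ]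
      push_cast
      linarith
  have h := main (e - t) (by omega) 0 (by omega)
  rw [show t + (e - t) = e by omega] at h
  have hD : (0 : ℝ) < (d ! : ℝ) ^ Fintype.card V := by positivity
  have hf : (0 : ℝ) < ((e - t)! : ℝ) := by positivity
  have h1 := le_nearRegularWeight_of_eq he
  rw [inv_le_iff_one_le_mul₀ hD] at h1
  have h2 : (e ! : ℝ) * 2 ^ e
      ≤ nearRegularWeight V d e * (d ! : ℝ) ^ Fintype.card V * (e ! * 2 ^ e) :=
    le_mul_of_one_le_left (by positivity) h1
  have h3 : nearRegularWeight V d e * (e ! * 2 ^ e)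
      ≤ nearRegularWeight V d t * (t ! * 2 ^ t) := by
    rw [← mul_le_mul_iff_left₀ hf]
    simp only [Nat.factorial_zero, Nat.cast_one] at h
    linarith
  have h4 := mul_le_mul_of_nonneg_right h3 hD.le
  linarith

end NearRegular

/-! ### Completing almost regular graphs by switchings -/

section Switching

open scoped Classical

variable {V : Type*}

/-- Replace the edge `xy` by the edges `ux` and `vy`. -/
def switch (G : SimpleGraph V) (u v x y : V) : SimpleGraph V :=
  (G \ edge x y) ⊔ edge u x ⊔ edge v y

theorem not_adj_before_switch {G : SimpleGraph V} {u v x y : V} (hxy : G.Adj x y)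
    (hux' : ¬ G.Adj u x) (hvy' : ¬ G.Adj v y) :
    ¬ (G \ edge x y).Adj u x ∧ ¬ ((G \ edge x y) ⊔ edge u x).Adj v y := by
  refine ⟨fun h => hux' h.1, ?_⟩
  rintro (h | h)
  · exact hvy' h.1
  · rw [edge_adj] at h
    rcases h with ⟨⟨rfl, rfl⟩ | ⟨rfl, rfl⟩, -⟩
    · exact hxy.ne rfl
    · exact hux' hxy.symm

theorem switch_inverse {G : SimpleGraph V} {u v x y : V} (hxy : G.Adj x y)
    (hux' : ¬ G.Adj u x) (hvy' : ¬ G.Adj v y) :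
    (switch G u v x y \ edge v y) \ edge u x ⊔ edge x y = G := by
  obtain ⟨h1, h2⟩ := not_adj_before_switch hxy hux' hvy'
  rw [switch, sup_edge_sdiff_edge h2, sup_edge_sdiff_edge h1, sdiff_edge_sup_edge hxy]

variable [Fintype V]

/-- The two indicators also cover u = v, a single vertex lacking two edges. -/
theorem exists_deficient_pair {d k : ℕ} {G : SimpleGraph V} (hG : G ∈ nearRegular V d (k + 1)) :
    ∃ u v, ∀ w, G.deg w + (if w = u then 1 else 0) + (if w = v then 1 else 0) ≤ d := by
  obtain ⟨h1, h2⟩ := mem_nearRegular.1 hG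
  obtain ⟨u, -, hu⟩ : ∃ u ∈ univ, G.deficit d u ≠ 0 := exists_ne_zero_of_sum_ne_zero (by omega)
  by_cases hu2 : 2 ≤ G.deficit d u
  · refine ⟨u, u, fun w => ?_⟩
    have := h1 w
    simp only [deficit] at hu2
    split_ifs with h
    · subst h; omega
    · omega
  · rw [← add_sum_erase _ _ (mem_univ u)] at h2
    obtain ⟨v, hv, hv'⟩ : ∃ v ∈ univ.erase u, G.deficit d v ≠ 0 :=
      exists_ne_zero_of_sum_ne_zero (by omega)
    refine ⟨u, v, fun w => ?_⟩
    have hne := ne_of_mem_erase hv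
    have := h1 w
    simp only [deficit] at hu hv'
    split_ifs with h h' h'
    · exact absurd (h'.symm.trans h) hne
    · subst h; omega
    · subst h'; omega
    · omega

/-- At most d(d+1) oriented edges start in the closed neighbourhood of u, and at most as many end in
that of v, so some oriented edge does neither. -/
theorem exists_adj_far {d : ℕ} {G : SimpleGraph V} (h : ∀ v, G.deg v ≤ d)
    (hlarge : 2 * (d * (d + 1)) < ∑ v, G.deg v) (u v : V) :
    ∃ x y, G.Adj x y ∧ x ≠ u ∧ ¬ G.Adj u x ∧ y ≠ v ∧ ¬ G.Adj v y := by
  by_contra! hcon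
  have hb : ∀ z, ∑ x ∈ univ.filter (fun x => x = z ∨ G.Adj z x), G.deg x ≤ d * (d + 1) := by
    intro z
    refine (sum_le_card_nsmul _ _ d fun x _ => h x).trans ?_
    rw [smul_eq_mul, mul_comm]
    exact Nat.mul_le_mul_left _ (card_closedNeighbour_le h z)
  have hsum : ∑ x, G.deg x
      ≤ ∑ x ∈ univ.filter (fun x => x = u ∨ G.Adj u x), G.deg x
        + ∑ y ∈ univ.filter (fun y => y = v ∨ G.Adj v y), G.deg y := by
    simp only [sum_filter, deg_eq_sum_ite]
    have e : ∑ y, (if y = v ∨ G.Adj v y then ∑ x, (if G.Adj y x then 1 else 0) else 0)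
        = ∑ x, ∑ y, (if y = v ∨ G.Adj v y then (if G.Adj y x then 1 else 0) else 0) := by
      rw [sum_comm]
      refine sum_congr rfl fun y _ => ?_
      split_ifs <;> simp
    rw [e, ← sum_add_distrib]
    refine sum_le_sum fun x _ => ?_
    by_cases hx : x = u ∨ G.Adj u x
    · rw [if_pos hx]; exact Nat.le_add_right _ _
    · rw [if_neg hx, zero_add]
      refine sum_le_sum fun y _ => ?_
      push Not at hx
      by_cases hxy : G.Adj x y
      · have hy : y = v ∨ G.Adj v y := by
          by_contra hy
          push Not at hy
          exact hy.2 (hcon x y hxy hx.1 hx.2 hy.1)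
        rw [if_pos hxy, if_pos hy, if_pos hxy.symm]
      · rw [if_neg hxy]; exact Nat.zero_le _
  have := hb u
  have := hb v
  omega

theorem switch_mem_nearRegular {d k : ℕ} {G : SimpleGraph V} (hG : G ∈ nearRegular V d (k + 1))
    {u v x y : V} (hdef : ∀ w, G.deg w + (if w = u then 1 else 0) + (if w = v then 1 else 0) ≤ d)
    (hxy : G.Adj x y) (hux : x ≠ u) (hux' : ¬ G.Adj u x) (hvy : y ≠ v) (hvy' : ¬ G.Adj v y) :
    switch G u v x y ∈ nearRegular V d k := by
  obtain ⟨h1, h2⟩ := not_adj_before_switch hxy hux' hvy'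
  have d0 := deg_sup_edge_of_not_adj hxy.ne (not_adj_sdiff_edge G x y)
  have s0 := sum_deg_sup_edge hxy.ne (not_adj_sdiff_edge G x y)
  rw [sdiff_edge_sup_edge hxy] at d0 s0
  have d1 := deg_sup_edge_of_not_adj hux.symm h1
  have s1 := sum_deg_sup_edge hux.symm h1
  have d2 := deg_sup_edge_of_not_adj hvy.symm h2
  have s2 := sum_deg_sup_edge hvy.symm h2
  have hs := sum_deg_add_of_mem_nearRegular hG
  refine mem_nearRegular_of_sum_deg (fun w => ?_) ?_
  · have := hdef w
    have := d0 w
    have := d1 w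
    have := d2 w
    rw [switch]
    omega
  · rw [switch]
    omega

theorem card_nearRegular_succ_le {d k : ℕ}
    (hlarge : 2 * (d * (d + 1)) + 2 * (k + 1) < d * Fintype.card V) :
    #(nearRegular V d (k + 1)) ≤ #(nearRegular V d k) * Fintype.card V ^ 4 := by
  -- The switched graph together with (u, v, x, y) determines the original graph.
  have hsub : nearRegular V d (k + 1) ⊆
      (nearRegular V d k ×ˢ (univ : Finset (V × V × V × V))).image fun p =>
        (p.1 \ edge p.2.2.1 p.2.2.2.2) \ edge p.2.1 p.2.2.2.1 ⊔ edge p.2.2.2.1 p.2.2.2.2 := by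
    intro G hG
    have hs := sum_deg_add_of_mem_nearRegular hG
    obtain ⟨u, v, hdef⟩ := exists_deficient_pair hG
    obtain ⟨x, y, hxy, hux, hux', hvy, hvy'⟩ :=
      exists_adj_far (mem_nearRegular.1 hG).1 (by omega) u v
    rw [mem_image]
    exact ⟨(switch G u v x y, u, v, x, y),
      mem_product.2 ⟨switch_mem_nearRegular hG hdef hxy hux hux' hvy hvy', mem_univ _⟩,
      switch_inverse hxy hux' hvy'⟩
  refine (card_le_card hsub).trans (card_image_le.trans (le_of_eq ?_))
  rw [card_product, card_univ]
  simp only [Fintype.card_prod]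
  ring

theorem card_nearRegular_le {d t : ℕ}
    (hlarge : 2 * (d * (d + 1)) + 2 * t < d * Fintype.card V) :
    #(nearRegular V d t) ≤ #(nearRegular V d 0) * Fintype.card V ^ (4 * t) := by
  induction t with
  | zero => simp
  | succ t ih =>
    refine (card_nearRegular_succ_le hlarge).trans ?_
    rw [show 4 * (t + 1) = 4 * t + 4 by ring, pow_add, ← mul_assoc]
    exact Nat.mul_le_mul_right _ (ih (by omega))

/-- A lower bound for the number of `d`-regular graphs that is sharp up to a polynomial factor. -/
theorem le_card_regular {d e t : ℕ} (he : d * Fintype.card V = 2 * e)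
    (ht : d * (d + 1) = 2 * t) (hlarge : 6 * t < d * Fintype.card V) :
    (e ! : ℝ) * 2 ^ e ≤ t ! * 2 ^ t * (d ! : ℝ) ^ Fintype.card V
      * (#(nearRegular V d 0) * (Fintype.card V : ℝ) ^ (4 * t)) := by
  refine (le_factorial_mul_nearRegularWeight he ht (by omega)).trans
    (mul_le_mul_of_nonneg_left ?_ (by positivity))
  refine (nearRegularWeight_le_card d t).trans ?_
  exact_mod_cast card_nearRegular_le (V := V) (d := d) (t := t) (by omega)

theorem regularGraphs_eq_nearRegular (d n : ℕ) :
    regularGraphs d n = nearRegular (Fin n) d 0 := by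
  ext G
  rw [mem_nearRegular_zero, regularGraphs, mem_filter]
  simp only [mem_univ, true_and, IsRegularOfDegree, deg_eq_degree]

end Switching

/-! ### Counting graphs with a frozen colouring -/

section Frozen

open scoped Classical

variable {V C : Type*}

/-- Every closed neighbourhood of `G` contains each colour of `α` exactly once. -/
def IsRainbow (G : SimpleGraph V) (α : V → C) : Prop :=
  ∀ v a, ∃! u, (u = v ∨ G.Adj v u) ∧ α u = a

/-- The unique vertex with colour `a` in the closed neighbourhood of `v`. -/
noncomputable def IsRainbow.next {G : SimpleGraph V} {α : V → C} (h : IsRainbow G α) (v : V)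
    (a : C) : V :=
  (h v a).choose

theorem IsRainbow.next_spec {G : SimpleGraph V} {α : V → C} (h : IsRainbow G α) (v : V) (a : C) :
    (h.next v a = v ∨ G.Adj v (h.next v a)) ∧ α (h.next v a) = a :=
  (h v a).choose_spec.1

theorem IsRainbow.eq_next {G : SimpleGraph V} {α : V → C} (h : IsRainbow G α) {u v : V}
    (huv : u = v ∨ G.Adj v u) : h.next v (α u) = u :=
  ((h v (α u)).choose_spec.2 u ⟨huv, rfl⟩).symm

theorem IsRainbow.next_next {G : SimpleGraph V} {α : V → C} (h : IsRainbow G α) (v : V) (a : C) :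
    h.next (h.next v a) (α v) = v :=
  h.eq_next ((h.next_spec v a).1.imp Eq.symm SimpleGraph.Adj.symm)

/-- The perfect matching between two colour classes. -/
noncomputable def IsRainbow.matching {G : SimpleGraph V} {α : V → C} (h : IsRainbow G α)
    (a b : C) : {v // α v = a} ≃ {v // α v = b} where
  toFun v := ⟨h.next v b, (h.next_spec v b).2⟩
  invFun v := ⟨h.next v a, (h.next_spec v a).2⟩
  left_inv := by rintro ⟨v, rfl⟩; exact Subtype.ext (h.next_next v b)
  right_inv := by rintro ⟨v, rfl⟩; exact Subtype.ext (h.next_next v a)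

theorem IsRainbow.adj_iff {G : SimpleGraph V} {α : V → C} (h : IsRainbow G α) {u v : V} :
    G.Adj u v ↔ α u ≠ α v ∧ h.next u (α v) = v := by
  refine ⟨fun huv => ⟨fun he => huv.ne ?_, h.eq_next (Or.inr huv)⟩, ?_⟩
  · rw [← h.eq_next (Or.inl (rfl : u = u)), he, h.eq_next (Or.inr huv)]
  · rintro ⟨hne, he⟩
    rcases (h.next_spec u (α v)).1 with h1 | h1
    · exact absurd (congrArg α (h1.symm.trans he)) hne
    · rwa [he] at h1

theorem IsRainbow.eq_of_next_eq [LinearOrder C] {G H : SimpleGraph V} {α : V → C}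
    (hG : IsRainbow G α) (hH : IsRainbow H α)
    (h : ∀ v b, α v < b → hG.next v b = hH.next v b) : G = H := by
  have key : ∀ u v, α u < α v → (G.Adj u v ↔ H.Adj u v) := fun u v huv => by
    rw [hG.adj_iff, hH.adj_iff, h u _ huv]
  ext u v
  rcases lt_trichotomy (α u) (α v) with huv | huv | huv
  · exact key u v huv
  · rw [hG.adj_iff, hH.adj_iff]
    simp [huv]
  · rw [G.adj_comm, H.adj_comm]
    exact key v u huv

variable [Fintype V]

/-- At most d+1 vertices show all d+1 colours, so no colour repeats. -/
theorem isRainbow_of_isFrozen {d : ℕ} {G : SimpleGraph V} (hG : ∀ v, G.deg v ≤ d)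
    {α : G.Coloring (Fin (d + 1))} (hα : IsFrozen α) : IsRainbow G α := by
  intro v a
  have himg : (univ.filter fun u => u = v ∨ G.Adj v u).image α = univ := by
    ext b
    obtain ⟨u, hu, rfl⟩ := hα v b
    simp only [mem_image, mem_filter, mem_univ, true_and, iff_true]
    exact ⟨u, hu, rfl⟩
  have hinj : Set.InjOn α (univ.filter fun u => u = v ∨ G.Adj v u : Finset V) := by
    refine card_image_iff.1 (le_antisymm card_image_le ?_)
    rw [himg, card_univ, Fintype.card_fin]
    exact card_closedNeighbour_le hG v
  obtain ⟨u, hu, rfl⟩ := hα v a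
  refine ⟨u, ⟨hu, rfl⟩, fun w hw => hinj ?_ ?_ hw.2⟩
  · simpa using hw.1
  · simpa using hu

theorem IsRainbow.card_class [Fintype C] {G : SimpleGraph V} {α : V → C} (h : IsRainbow G α)
    (a : C) : Fintype.card V = Fintype.card C * Fintype.card {v // α v = a} := by
  rw [← Fintype.card_congr (Equiv.sigmaFiberEquiv α), Fintype.card_sigma,
    sum_congr rfl fun b _ => Fintype.card_congr (h.matching b a), sum_const, card_univ,
    smul_eq_mul]

theorem two_mul_card_pairs_lt (k : ℕ) :
    2 * Fintype.card {p : Fin k × Fin k // p.1 < p.2} = k * (k - 1) := by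
  rw [← sum_range_id_mul_two, ← Fin.sum_univ_eq_sum_range, mul_comm, Fintype.card_subtype,
    card_filter, Fintype.sum_prod_type_right]
  congr 1
  refine sum_congr rfl fun b _ => ?_
  rw [← card_filter, ← Fin.card_Iio]
  congr 1
  ext; simp

/-- The graph is determined by its t matchings between classes a < b, each a bijection of m-sets. -/
theorem card_isRainbow_le {k m t : ℕ} (hk : 0 < k) (ht : k * (k - 1) = 2 * t)
    (hV : Fintype.card V = k * m) (α : V → Fin k) :
    #(univ.filter fun G : SimpleGraph V => IsRainbow G α) ≤ (m !) ^ t := by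
  -- A rainbow graph is needed to know that all classes of α have size m.
  rcases (univ.filter fun G : SimpleGraph V => IsRainbow G α).eq_empty_or_nonempty with
    he | ⟨G, hG⟩
  · simp [he]
  have hG' : IsRainbow G α := (mem_filter.1 hG).2
  have hclass : ∀ a, Fintype.card {v // α v = a} = m := fun a => by
    have := hG'.card_class a
    rw [hV, Fintype.card_fin] at this
    convert (Nat.eq_of_mul_eq_mul_left hk this).symm
  rw [← Fintype.card_subtype]
  let f : {G : SimpleGraph V // IsRainbow G α} →
      ∀ p : {p : Fin k × Fin k // p.1 < p.2}, {v // α v = p.1.1} ≃ {v // α v = p.1.2} :=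
    fun G p => G.2.matching p.1.1 p.1.2
  have hf : Function.Injective f := by
    rintro ⟨G, hG⟩ ⟨H, hH⟩ hGH
    refine Subtype.ext (hG.eq_of_next_eq hH fun v b hb => ?_)
    have := congrFun hGH ⟨(α v, b), hb⟩
    exact congrArg Subtype.val (DFunLike.congr_fun this ⟨v, rfl⟩)
  refine (Fintype.card_le_of_injective f hf).trans (le_of_eq ?_)
  rw [Fintype.card_pi, prod_congr rfl fun p _ =>
    (Fintype.card_equiv (hG'.matching p.1.1 p.1.2)).trans (by rw [hclass]), prod_const,
    card_univ]
  congr 1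
  have := two_mul_card_pairs_lt k
  omega

theorem frozen_subset_biUnion (d n : ℕ) :
    (regularGraphs d n).filter (fun G => HasFrozenColouring G (d + 1)) ⊆
      (univ : Finset (Fin n → Fin (d + 1))).biUnion fun α =>
        univ.filter fun G => IsRainbow G α := by
  intro G hG
  rw [mem_filter, regularGraphs_eq_nearRegular, mem_nearRegular_zero] at hG
  obtain ⟨hG, α, hα⟩ := hG
  simp only [mem_biUnion, mem_filter, mem_univ, true_and]
  exact ⟨α, isRainbow_of_isFrozen (fun v => (hG v).le) hα⟩

theorem card_frozen_le {d m t : ℕ} (ht : d * (d + 1) = 2 * t) :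
    #((regularGraphs d ((d + 1) * m)).filter fun G => HasFrozenColouring G (d + 1))
      ≤ (d + 1) ^ ((d + 1) * m) * (m !) ^ t := by
  have hle : ∀ α : Fin ((d + 1) * m) → Fin (d + 1),
      #(univ.filter fun G => IsRainbow G α) ≤ (m !) ^ t := fun α => by
    have hk : (d + 1) * (d + 1 - 1) = 2 * t := by rw [Nat.add_sub_cancel, mul_comm, ht]
    convert card_isRainbow_le d.succ_pos hk (Fintype.card_fin _) α
  refine (card_le_card (frozen_subset_biUnion d _)).trans (card_biUnion_le.trans ?_)
  refine (sum_le_card_nsmul _ _ _ fun α _ => hle α).trans (le_of_eq ?_)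
  simp

theorem frozen_eq_empty {d n : ℕ} (h : ¬ d + 1 ∣ n) :
    (regularGraphs d n).filter (fun G => HasFrozenColouring G (d + 1)) = ∅ := by
  by_contra hne
  obtain ⟨G, hG⟩ := nonempty_iff_ne_empty.2 hne
  have := frozen_subset_biUnion d n hG
  simp only [mem_biUnion, mem_filter, mem_univ, true_and] at this
  obtain ⟨α, hα⟩ := this
  have hc := hα.card_class 0
  rw [Fintype.card_fin, Fintype.card_fin] at hc
  exact h ⟨_, hc⟩

end Frozen

/-! ### Stirling-type bounds and the numerical comparison -/

theorem pow_self_le_factorial_mul_exp (n : ℕ) : (n : ℝ) ^ n ≤ n ! * Real.exp n := by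
  have h := Real.pow_div_factorial_le_exp (n : ℝ) n.cast_nonneg n
  rwa [div_le_iff₀ (by positivity), mul_comm] at h

theorem factorial_mul_exp_le {m : ℕ} (hm : 1 ≤ m) :
    (m ! : ℝ) * Real.exp m ≤ Real.exp 1 * (m : ℝ) ^ (m + 1) := by
  induction m, hm using Nat.le_induction with
  | base => simp
  | succ m hm ih =>
    have hpos : (0 : ℝ) < m + 1 := by positivity
    have h1 : (m : ℝ) / (m + 1) ≤ Real.exp (-(1 / (m + 1))) := by
      refine le_trans (le_of_eq ?_) (Real.add_one_le_exp _)
      field_simp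
      ring
    have h2 : ((m : ℝ) / (m + 1)) ^ (m + 1) ≤ Real.exp (-1) := by
      refine (pow_le_pow_left₀ (by positivity) h1 _).trans (le_of_eq ?_)
      rw [← Real.exp_nat_mul]
      congr 1
      push_cast
      field_simp
    rw [div_pow, div_le_iff₀ (by positivity), Real.exp_neg, ← div_eq_inv_mul,
      le_div_iff₀ (Real.exp_pos 1)] at h2
    rw [Nat.factorial_succ, Nat.cast_mul, Nat.cast_succ, Real.exp_add, pow_succ]
    calc ((m : ℝ) + 1) * m ! * (Real.exp m * Real.exp 1)
        = (m + 1) * Real.exp 1 * (m ! * Real.exp m) := by ring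
      _ ≤ (m + 1) * Real.exp 1 * (Real.exp 1 * (m : ℝ) ^ (m + 1)) := by gcongr
      _ = (m + 1) * Real.exp 1 * ((m : ℝ) ^ (m + 1) * Real.exp 1) := by ring
      _ ≤ (m + 1) * Real.exp 1 * ((m : ℝ) + 1) ^ (m + 1) := by gcongr
      _ = _ := by ring

/-- With R the midpoint of P and Q, the ratio P/R absorbs the polynomial and R/Q = e^(-c). -/
theorem exists_polynomial_mul_pow_le (K : ℝ) (j : ℕ) {P Q : ℝ} (hP : 0 ≤ P) (hPQ : P < Q) :
    ∃ c : ℝ, 0 < c ∧ ∃ m₀ : ℕ, ∀ m : ℕ, m₀ ≤ m →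
      K * (m : ℝ) ^ j * P ^ m ≤ Real.exp (-c * m) * Q ^ m := by
  have hQ : 0 < Q := hP.trans_lt hPQ
  have hR : 0 < (P + Q) / 2 := by linarith
  have hs : 0 < (P + Q) / 2 / Q := by positivity
  have hs1 : (P + Q) / 2 / Q < 1 := by rw [div_lt_one hQ]; linarith
  have ht := (tendsto_pow_const_mul_const_pow_of_lt_one j (r := P / ((P + Q) / 2))
    (by positivity) (by rw [div_lt_one hR]; linarith)).const_mul K
  rw [mul_zero] at ht
  obtain ⟨m₀, hm₀⟩ := Filter.eventually_atTop.1 (ht.eventually_le_const zero_lt_one)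
  refine ⟨-Real.log ((P + Q) / 2 / Q), by linarith [Real.log_neg hs hs1], m₀, fun m hm => ?_⟩
  have h := hm₀ m hm
  rw [div_pow, ← mul_div_assoc, ← mul_div_assoc, div_le_one (by positivity), ← mul_assoc] at h
  refine h.trans (le_of_eq ?_)
  rw [neg_neg, mul_comm (Real.log _), Real.exp_nat_mul, Real.exp_log hs, ← mul_pow,
    div_mul_cancel₀ _ hQ.ne']

/-- Degree at least 3 is essential here: at d = 2 both sides equal 36. -/
theorem factorial_succ_sq_lt {d : ℕ} (hd : 3 ≤ d) : ((d + 1)!) ^ 2 < (d * (d + 1)) ^ d := by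
  induction d, hd using Nat.le_induction with
  | base => decide
  | succ d hd ih =>
    obtain ⟨j, rfl⟩ : ∃ j, d = j + 1 := ⟨d - 1, by omega⟩
    have h : (j + 1) ^ j ≤ (j + 3) ^ j := Nat.pow_le_pow_left (by omega) _
    rw [Nat.factorial_succ, mul_pow]
    calc (j + 1 + 1 + 1) ^ 2 * (j + 1 + 1)! ^ 2
        < (j + 1 + 1 + 1) ^ 2 * ((j + 1) * (j + 1 + 1)) ^ (j + 1) := by gcongr
      _ = (j + 3) ^ 2 * (j + 2) ^ (j + 1) * (j + 1) * (j + 1) ^ j := by rw [mul_pow]; ring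
      _ ≤ (j + 3) ^ 2 * (j + 2) ^ (j + 1) * (j + 2) * (j + 3) ^ j := by gcongr; omega
      _ = _ := by rw [mul_pow]; ring

/-- The bound for the number of pairs of a graph and a frozen colouring, compared with the bound for
the number of regular graphs on `(d + 1) * m` vertices. -/
theorem exists_frozen_bound_le {d t : ℕ} (hd : 3 ≤ d) (ht : d * (d + 1) = 2 * t) :
    ∃ c : ℝ, 0 < c ∧ ∃ m₀ : ℕ, ∀ m : ℕ, m₀ ≤ m →
      (d + 1 : ℝ) ^ ((d + 1) * m) * (m ! : ℝ) ^ t * (t ! * 2 ^ t * (d ! : ℝ) ^ ((d + 1) * m))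
          * ((d + 1) * m : ℝ) ^ (4 * t)
        ≤ Real.exp (-c * m) * ((t * m)! * 2 ^ (t * m)) := by
  -- The (d+1)-st power of `factorial_succ_sq_lt`, followed by a square root.
  have hPQ : (((d + 1)! : ℝ) ^ (d + 1)) < (2 * t : ℝ) ^ t := by
    have h1 := Nat.pow_lt_pow_left (factorial_succ_sq_lt hd) (n := d + 1) (by omega)
    rw [ht, ← pow_mul, ← pow_mul, ht, mul_comm 2 (d + 1), pow_mul, mul_comm 2 t, pow_mul] at h1
    have h2 := lt_of_pow_lt_pow_left₀ 2 (Nat.zero_le _) h1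
    rw [mul_comm t 2] at h2
    exact_mod_cast h2
  -- The exponent 5t is 4t from the switchings plus t from the spare factor m in the upper bound for
  -- m!.
  obtain ⟨c, hc, m₀, hm₀⟩ := exists_polynomial_mul_pow_le
    (Real.exp 1 ^ t * t ! * 2 ^ t * (d + 1 : ℝ) ^ (4 * t)) (5 * t) (by positivity) hPQ
  refine ⟨c, hc, max m₀ 1, fun m hm => ?_⟩
  have hm1 : 1 ≤ m := (le_max_right _ _).trans hm
  have h := hm₀ m ((le_max_left _ _).trans hm)
  have hup : (m ! : ℝ) ^ t * Real.exp (t * m) ≤ Real.exp 1 ^ t * (m : ℝ) ^ ((m + 1) * t) := by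
    rw [Real.exp_nat_mul, ← mul_pow, pow_mul, ← mul_pow]
    exact pow_le_pow_left₀ (by positivity) (factorial_mul_exp_le hm1) t
  have hlow : (t * m : ℝ) ^ (t * m) ≤ (t * m)! * Real.exp (t * m) := by
    exact_mod_cast pow_self_le_factorial_mul_exp (t * m)
  rw [← mul_le_mul_iff_left₀ (Real.exp_pos (t * m))]
  calc (d + 1 : ℝ) ^ ((d + 1) * m) * (m ! : ℝ) ^ t * (t ! * 2 ^ t * (d ! : ℝ) ^ ((d + 1) * m))
          * ((d + 1) * m : ℝ) ^ (4 * t) * Real.exp (t * m)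
      = ((d + 1 : ℝ) * d !) ^ ((d + 1) * m) * (t ! * 2 ^ t) * ((d + 1) * m : ℝ) ^ (4 * t)
          * ((m ! : ℝ) ^ t * Real.exp (t * m)) := by rw [mul_pow (d + 1 : ℝ) (d ! : ℝ)]; ring
    _ ≤ ((d + 1 : ℝ) * d !) ^ ((d + 1) * m) * (t ! * 2 ^ t) * ((d + 1) * m : ℝ) ^ (4 * t)
          * (Real.exp 1 ^ t * (m : ℝ) ^ ((m + 1) * t)) := by gcongr
    _ = Real.exp 1 ^ t * t ! * 2 ^ t * (d + 1 : ℝ) ^ (4 * t) * (m : ℝ) ^ (5 * t)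
          * (((d + 1)! : ℝ) ^ (d + 1)) ^ m * (m : ℝ) ^ (t * m) := by
        rw [Nat.factorial_succ]
        push_cast
        rw [← pow_mul, mul_pow ((d : ℝ) + 1) (m : ℝ)]
        ring
    _ ≤ Real.exp (-c * m) * ((2 * t : ℝ) ^ t) ^ m * (m : ℝ) ^ (t * m) := by gcongr
    _ = Real.exp (-c * m) * 2 ^ (t * m) * (t * m : ℝ) ^ (t * m) := by
        rw [← pow_mul, mul_pow, mul_pow]
        ring
    _ ≤ Real.exp (-c * m) * 2 ^ (t * m) * ((t * m)! * Real.exp (t * m)) := by gcongr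
    _ = _ := by ring

/-! ### Existence of regular graphs and the probability bound -/

theorem regularGraphs_nonempty {d n : ℕ} (hd : 0 < d) (hn : 3 * (d + 1) < n)
    (heven : Even (d * n)) : (regularGraphs d n).Nonempty := by
  obtain ⟨e, he⟩ := even_iff_two_dvd.1 heven
  obtain ⟨t, ht⟩ := even_iff_two_dvd.1 (Nat.even_mul_succ_self d)
  have hlarge : 6 * t < d * n := by
    have := Nat.mul_lt_mul_of_pos_left hn hd
    have h2 : d * (3 * (d + 1)) = 3 * (d * (d + 1)) := by ring
    omega
  have h := le_card_regular (V := Fin n) (d := d) (by simpa using he) ht (by simpa using hlarge)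
  rw [regularGraphs_eq_nearRegular, ← card_pos, Nat.pos_iff_ne_zero]
  intro h0
  rw [h0, Nat.cast_zero, zero_mul, mul_zero] at h
  have : (0 : ℝ) < e ! * 2 ^ e := by positivity
  linarith

open Classical in
theorem exists_card_frozen_le {d : ℕ} (hd : 3 ≤ d) :
    ∃ c : ℝ, 0 < c ∧ ∃ n₀ : ℕ, ∀ n : ℕ, n₀ ≤ n → Even (d * n) →
      (#((regularGraphs d n).filter fun G => HasFrozenColouring G (d + 1)) : ℝ)
        ≤ Real.exp (-c * n) * #(regularGraphs d n) := by
  obtain ⟨t, ht⟩ := even_iff_two_dvd.1 (Nat.even_mul_succ_self d)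
  obtain ⟨c, hc, m₀, hm₀⟩ := exists_frozen_bound_le hd ht
  -- Decay in m = n/(d+1) becomes decay in n; n > 3(d+1) gives 6t < dn, as the switchings require.
  refine ⟨c / (d + 1), by positivity, max ((d + 1) * m₀) (3 * (d + 1) + 1), fun n hn heven => ?_⟩
  by_cases hdvd : d + 1 ∣ n
  swap
  · rw [frozen_eq_empty hdvd, card_empty, Nat.cast_zero]
    positivity
  obtain ⟨m, rfl⟩ := hdvd
  have hm : m₀ ≤ m := Nat.le_of_mul_le_mul_left ((le_max_left _ _).trans hn) d.succ_pos
  have hn' : 3 * (d + 1) < (d + 1) * m := (le_max_right _ _).trans hn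
  have hlarge : 6 * t < d * ((d + 1) * m) := by
    have := Nat.mul_lt_mul_of_pos_left hn' (show 0 < d by omega)
    have h2 : d * (3 * (d + 1)) = 3 * (d * (d + 1)) := by ring
    omega
  have he : d * ((d + 1) * m) = 2 * (t * m) := by rw [← mul_assoc, ht, mul_assoc]
  have hlow := le_card_regular (V := Fin ((d + 1) * m)) (d := d) (by simpa using he) ht
    (by simpa using hlarge)
  rw [← regularGraphs_eq_nearRegular, Fintype.card_fin] at hlow
  push_cast at hlow
  have hup : (#((regularGraphs d ((d + 1) * m)).filter fun G => HasFrozenColouring G (d + 1)) : ℝ)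
      ≤ (d + 1 : ℝ) ^ ((d + 1) * m) * (m ! : ℝ) ^ t := by
    exact_mod_cast card_frozen_le ht
  have hb := hm₀ m hm
  have hexp : -(c / (d + 1)) * (((d + 1) * m : ℕ) : ℝ) = -c * m := by
    push_cast
    field_simp
  rw [hexp]
  generalize (#((regularGraphs d ((d + 1) * m)).filter
    fun G => HasFrozenColouring G (d + 1)) : ℝ) = F at hup ⊢
  generalize (#(regularGraphs d ((d + 1) * m)) : ℝ) = N at hlow ⊢
  have hpos : (0 : ℝ) < (t * m)! * 2 ^ (t * m) := by positivity
  -- The generalization forgot that N is a cardinality; the lower bound `hlow` restores its sign.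
  have hN : 0 ≤ N := by
    by_contra hneg
    have hq : (0 : ℝ) ≤ t ! * 2 ^ t * (d ! : ℝ) ^ ((d + 1) * m) * ((d + 1) * m : ℝ) ^ (4 * t) := by
      positivity
    nlinarith [mul_nonneg hq (neg_nonneg.2 (not_le.1 hneg).le)]
  rw [← mul_le_mul_iff_left₀ hpos]
  calc F * ((t * m)! * 2 ^ (t * m))
      ≤ ((d + 1 : ℝ) ^ ((d + 1) * m) * (m ! : ℝ) ^ t) * (t ! * 2 ^ t * (d ! : ℝ) ^ ((d + 1) * m)
          * (N * ((d + 1) * m : ℝ) ^ (4 * t))) := by gcongr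
    _ = ((d + 1 : ℝ) ^ ((d + 1) * m) * (m ! : ℝ) ^ t
          * (t ! * 2 ^ t * (d ! : ℝ) ^ ((d + 1) * m)) * ((d + 1) * m : ℝ) ^ (4 * t)) * N := by ring
    _ ≤ (Real.exp (-c * m) * ((t * m)! * 2 ^ (t * m))) * N := by gcongr
    _ = _ := by ring

theorem mainTheorem6 (Δ : ℕ) (hΔ : 3 ≤ Δ) :
    ∃ (c : ℝ) (n₀ : ℕ), 0 < c ∧ 0 < n₀ ∧ ∀ n : ℕ, n₀ ≤ n → Even (Δ * n) →
      ∃ h : (regularGraphs Δ n).Nonempty,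
        (randomRegularGraph Δ n h).toOuterMeasure {G | HasFrozenColouring G (Δ + 1)} ≤
          ENNReal.ofReal (Real.exp (-c * n)) := by
  classical
  obtain ⟨c, hc, n₀, hn₀⟩ := exists_card_frozen_le hΔ
  refine ⟨c, max n₀ (3 * (Δ + 1) + 1), hc, by positivity, fun n hn heven => ?_⟩
  have h := regularGraphs_nonempty (by omega) ((le_max_right _ _).trans hn) heven
  refine ⟨h, ?_⟩
  rw [randomRegularGraph, PMF.toOuterMeasure_uniformOfFinset_apply]
  have hpos : (#(regularGraphs Δ n) : ENNReal) ≠ 0 := by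
    simpa using h.ne_empty
  rw [ENNReal.div_le_iff hpos (ENNReal.natCast_ne_top _), ← ENNReal.ofReal_natCast,
    ← ENNReal.ofReal_natCast, ← ENNReal.ofReal_mul (Real.exp_pos _).le]
  refine ENNReal.ofReal_le_ofReal ?_
  convert hn₀ n ((le_max_left _ _).trans hn) heven using 4
  rfl
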